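/- **Theorem (Elton's Ergodic Theorem for GIFS).** Let $(X,d)$ be a non-empty compact metric space, let $m,n\ge 1$, and equip $X^m$ with the maximum metric. Let $\mathcal S=(X,(\phi_j)_{j=0}^{n-1},(p_j)_{j=0}^{n-1})$ be a generalized iterated function system with place-dependent probabilities of degree $m$: the maps $\phi_j:X^m\to X$ and the weights $p_j:X^m\to[0,1]$ are continuous and $\sum_j p_j\equiv 1$. Assume * (E1) for each $j$ there are $a_{j,0},\dots,a_{j,m-1}>0$ with $\sum_i a_{j,i}<1$ and $d(\phi_j(x),\phi_j(y))\le\sum_i a_{j,i}\,d(x_i,y_i)$ for all $x,y\in X^m$; * (E2) there is $\delta>0$ with $p_j(x)\ge\delta$ for all $j$ and all $x\in X^m$, and for each $j$ there are $c_{j,0},\dots,c_{j,m-1}>0$ with $\sum_i c_{j,i}<1$ and $|p_j(x)-p_j(y)|\le\sum_i c_{j,i}\,d(x_i,y_i)$ for all $x,y\in X^m$. For $x=(x_0,\dots,x_{m-1})\in X^m$ and $w=(w_0,w_1,\dots)\in\Omega=\{0,\dots,n-1\}^{\mathbb N}$ let $(x_k(w))_{k\ge0}$ be the orbit given by $x_k(w)=x_k$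 for $k<m$ and $x_{k+m}(w)=\phi_{w_k}(x_k(w),\dots,x_{k+m-1}(w))$ for $k\ge 0$, and let $P_x$ be the Borel probability on $\Omega$ that gives each cylinder the mass $$P_x(\overline{w_0\cdots w_{k-1}})=\prod_{l=0}^{k-1}p_{w_l}(x_l(w),\dots,x_{l+m-1}(w)).$$ Let $\hat\phi_j(x_0,\dots,x_{m-1})=(x_1,\dots,x_{m-1},\phi_j(x_0,\dots,x_{m-1}))$, and let $\mathcal L_{\hat{\mathcal S}}$ be the Markov operator on Borel probabilities on $X^m$ with $\int g\,d\mathcal L_{\hat{\mathcal S}}(\alpha)=\int\sum_j p_j\,(g\circ\hat\phi_j)\,d\alpha$ for all continuous $g:X^m\to\mathbb R$. Then $\mathcal L_{\hat{\mathcal S}}$ has a unique fixed point $\alpha$ (the extended Hutchinson measure), all $m$ marginals of $\alpha$ on $X$ are equal to one probability $\mu_\alpha$ (the projected Hutchinson measure), and for each $x\in X^m$ there is a measurable set $\Omega_x\subseteq\Omega$ with $P_x(\Omega_x)=1$ such that for every $w\in\Omega_x$ and every continuous $f:X\to\mathbb R$, $$\frac1K\sum_{k=0}^{K-1}f(x_k(w))\longrightarrow\int_X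 f\,d\mu_\alpha\qquad(K\to\infty).$$ -/

import Mathlib

open MeasureTheory ProbabilityTheory Filter Topology
open scoped ENNReal

/-- A (continuous) generalized iterated function system with place dependent probabilities, of
degree `m` and with `n` maps: continuous maps `φ j : X ^ m → X` and continuous weights
`p j : X ^ m → [0, 1]` that sum to `1`. The space `X ^ m = (Fin m → X)` carries the maximum
metric. -/
structure GIFSpdp (X : Type*) [MetricSpace X] (m n : ℕ) where
  /-- the maps -/
  φ : Fin n → C(Fin m → X, X)
  /-- the weights -/
  p : Fin n → C(Fin m → X, ℝ)
  p_mem : ∀ j x, p j x ∈ Set.Icc (0 : ℝ) 1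
  p_sum : ∀ x, ∑ j, p j x = 1

/-- `f : X ^ m → Y` satisfies `d (f x, f y) ≤ ∑ i, a i * d (x i, y i)`, with all `a i > 0`. -/
def LipWith {X Y : Type*} [MetricSpace X] [MetricSpace Y] {m : ℕ} (a : Fin m → ℝ)
    (f : (Fin m → X) → Y) : Prop :=
  (∀ i, 0 < a i) ∧ ∀ x y, dist (f x) (f y) ≤ ∑ i, a i * dist (x i) (y i)

namespace GIFSpdp

variable {X : Type*} [MetricSpace X] {m n : ℕ}

/-- Contraction hypothesis on the maps. -/
def E1 (S : GIFSpdp X m n) : Prop :=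
  ∀ j, ∃ a : Fin m → ℝ, LipWith a (S.φ j) ∧ ∑ i, a i < 1

/-- Hypothesis on the weights: bounded away from `0`, and Lipschitz. -/
def E2 (S : GIFSpdp X m n) : Prop :=
  (∃ δ : ℝ, 0 < δ ∧ ∀ j x, δ ≤ S.p j x) ∧
    ∀ j, ∃ c : Fin m → ℝ, LipWith c (S.p j) ∧ ∑ i, c i < 1

/-- The orbit of `x = (x_0, …, x_{m-1})` along the symbol sequence `w`: it starts with
`x_0, …, x_{m-1}`, and `x_{k+m} = φ_{w_k} (x_k, …, x_{k+m-1})` (see `orbit_add`). -/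
def orbit (S : GIFSpdp X m n) (x : Fin m → X) (w : ℕ → Fin n) (k : ℕ) : X :=
  if h : k < m then x ⟨k, h⟩
  else S.φ (w (k - m)) fun i : Fin m => S.orbit x w (k - m + i)
termination_by k
decreasing_by omega

/-- The block `(x_k, …, x_{k+m-1})` of the orbit. -/
def block (S : GIFSpdp X m n) (x : Fin m → X) (w : ℕ → Fin n) (k : ℕ) : Fin m → X :=
  fun i => S.orbit x w (k + i)

theorem orbit_of_lt (S : GIFSpdp X m n) (x : Fin m → X) (w : ℕ → Fin n) (i : Fin m) :
    S.orbit x w i = x i := by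
  rw [orbit, dif_pos i.2]

theorem orbit_add (S : GIFSpdp X m n) (x : Fin m → X) (w : ℕ → Fin n) (k : ℕ) :
    S.orbit x w (k + m) = S.φ (w k) (S.block x w k) := by
  rw [orbit, dif_neg (by omega)]
  simp only [Nat.add_sub_cancel]
  rfl

theorem orbit_congr (S : GIFSpdp X m n) (x : Fin m → X) {w v : ℕ → Fin n} (k : ℕ)
    (h : ∀ l, l + m ≤ k → w l = v l) : S.orbit x w k = S.orbit x v k := by
  induction k using Nat.strong_induction_on with
  | _ k ih =>
    by_cases hk : k < m
    · have h1 := S.orbit_of_lt x w ⟨k, hk⟩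
      have h2 := S.orbit_of_lt x v ⟨k, hk⟩
      exact h1.trans h2.symm
    · obtain ⟨l, rfl⟩ : ∃ l, k = l + m := ⟨k - m, by omega⟩
      rw [orbit_add, orbit_add, h l le_rfl]
      congr 1
      funext i
      exact ih (l + i) (by omega) fun q hq => h q (by omega)

theorem block_congr (S : GIFSpdp X m n) (x : Fin m → X) {w v : ℕ → Fin n} (k : ℕ)
    (h : ∀ l, l < k → w l = v l) : S.block x w k = S.block x v k := by
  funext i
  exact S.orbit_congr x _ fun l hl => h l (by omega)

/-- The maps `φ̂_j (x_0, …, x_{m-1}) = (x_1, …, x_{m-1}, φ_j (x_0, …, x_{m-1}))` of the extension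
of `S` to an iterated function system on `X ^ m`. -/
def extMap (S : GIFSpdp X m n) (j : Fin n) (x : Fin m → X) : Fin m → X :=
  fun i => if h : (i : ℕ) + 1 < m then x ⟨i + 1, h⟩ else S.φ j x

theorem continuous_extMap (S : GIFSpdp X m n) (j : Fin n) : Continuous (S.extMap j) := by
  refine continuous_pi fun i => ?_
  unfold extMap
  split_ifs
  · fun_prop
  · exact (S.φ j).continuous

theorem block_zero (S : GIFSpdp X m n) (x : Fin m → X) (w : ℕ → Fin n) : S.block x w 0 = x := by
  funext i
  simpa [block] using S.orbit_of_lt x w i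

/-- The blocks of the orbit of `S` are the orbit of the extension. -/
theorem block_succ (S : GIFSpdp X m n) (x : Fin m → X) (w : ℕ → Fin n) (k : ℕ) :
    S.block x w (k + 1) = S.extMap (w k) (S.block x w k) := by
  funext i
  unfold extMap
  split_ifs with h
  · simp only [block]
    congr 1
    omega
  · rw [← orbit_add, block]
    congr 1
    omega

/-- The transfer operator `B̂ g (x) = ∑ j, p_j (x) g (φ̂_j (x))` of the extension. -/
noncomputable def extTransfer (S : GIFSpdp X m n) (g : C(Fin m → X, ℝ)) : C(Fin m → X, ℝ) :=
  ∑ j, S.p j * g.comp ⟨S.extMap j, S.continuous_extMap j⟩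

theorem extTransfer_apply (S : GIFSpdp X m n) (g : C(Fin m → X, ℝ)) (x : Fin m → X) :
    S.extTransfer g x = ∑ j, S.p j x * g (S.extMap j x) := by
  simp [extTransfer]

theorem sum_ofReal_p (S : GIFSpdp X m n) (x : Fin m → X) :
    ∑ j, ENNReal.ofReal (S.p j x) = 1 := by
  rw [← ENNReal.ofReal_sum_of_nonneg fun j _ => (S.p_mem j x).1, S.p_sum, ENNReal.ofReal_one]

section Markov

variable [CompactSpace X] [MeasurableSpace X] [BorelSpace X]

/-- The Markov operator of the extension, on measures: the image of `α` is
`∑ j, (φ̂_j)_* (p_j α)`. -/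
noncomputable def extMarkovMeasure (S : GIFSpdp X m n) (α : Measure (Fin m → X)) :
    Measure (Fin m → X) :=
  ∑ j, (α.withDensity fun x => ENNReal.ofReal (S.p j x)).map (S.extMap j)

theorem isProbabilityMeasure_extMarkovMeasure (S : GIFSpdp X m n) (α : Measure (Fin m → X))
    [IsProbabilityMeasure α] : IsProbabilityMeasure (S.extMarkovMeasure α) := by
  constructor
  have hp : ∀ j, Measurable fun x => ENNReal.ofReal (S.p j x) := fun j =>
    ((S.p j).continuous.measurable).ennreal_ofReal
  simp only [extMarkovMeasure, Measure.coe_finsetSum, Finset.sum_apply]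
  have : ∀ j, ((α.withDensity fun x => ENNReal.ofReal (S.p j x)).map (S.extMap j)) Set.univ
      = ∫⁻ x, ENNReal.ofReal (S.p j x) ∂α := fun j => by
    rw [Measure.map_apply (S.continuous_extMap j).measurable .univ, Set.preimage_univ,
      withDensity_apply _ .univ, Measure.restrict_univ]
  simp only [this]
  rw [← lintegral_finsetSum _ fun j _ => hp j]
  simp [S.sum_ofReal_p]

/-- The Markov operator `L̂ : Prob (X ^ m) → Prob (X ^ m)` of the extension. -/
noncomputable def extMarkov (S : GIFSpdp X m n) (α : ProbabilityMeasure (Fin m → X)) :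
    ProbabilityMeasure (Fin m → X) :=
  ⟨S.extMarkovMeasure (α : Measure (Fin m → X)),
    S.isProbabilityMeasure_extMarkovMeasure (α : Measure (Fin m → X))⟩

/-- The duality that characterizes the Markov operator: `∫ g d(L̂ α) = ∫ B̂ g dα`. -/
theorem integral_extMarkov (S : GIFSpdp X m n) (α : ProbabilityMeasure (Fin m → X))
    (g : C(Fin m → X, ℝ)) :
    ∫ x, g x ∂(S.extMarkov α : Measure (Fin m → X)) =
      ∫ x, S.extTransfer g x ∂(α : Measure (Fin m → X)) := by
  have hInt : ∀ f : C(Fin m → X, ℝ), ∀ ν : Measure (Fin m → X), [IsFiniteMeasure ν] →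
      Integrable (fun x => f x) ν := fun f ν _ =>
    f.continuous.integrable_of_hasCompactSupport (HasCompactSupport.of_compactSpace _)
  have hfin : ∀ j, IsFiniteMeasure ((α : Measure (Fin m → X)).withDensity fun x =>
      ENNReal.ofReal (S.p j x)) := fun j =>
    isFiniteMeasure_withDensity_ofReal (hInt (S.p j) _).2
  have h0 : (S.extMarkov α : Measure (Fin m → X)) = ∑ j,
      ((α : Measure (Fin m → X)).withDensity fun x => ENNReal.ofReal (S.p j x)).map
        (S.extMap j) := rfl
  rw [h0, integral_finsetSum_measure fun j _ => hInt g _]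
  simp only [extTransfer_apply]
  have hprod : ∀ j, Integrable (fun x => S.p j x * g (S.extMap j x))
      (α : Measure (Fin m → X)) := fun j =>
    hInt (S.p j * g.comp ⟨S.extMap j, S.continuous_extMap j⟩) _
  rw [integral_finsetSum _ fun j _ => hprod j]
  refine Finset.sum_congr rfl fun j _ => ?_
  rw [integral_map (S.continuous_extMap j).measurable.aemeasurable
    g.continuous.aestronglyMeasurable]
  have hd := integral_withDensity_eq_integral_toReal_smul
    (μ := (α : Measure (Fin m → X))) (f := fun x => ENNReal.ofReal (S.p j x))
    ((S.p j).continuous.measurable.ennreal_ofReal) (by simp) (fun x => g (S.extMap j x))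
  rw [hd]
  refine integral_congr_ae (Eventually.of_forall fun x => ?_)
  simp [ENNReal.toReal_ofReal (S.p_mem j x).1]

/-- `α` is the extended Hutchinson measure of `S`: the unique fixed point of the Markov operator
of the extension. -/
def IsExtendedHutchinson (S : GIFSpdp X m n) (α : ProbabilityMeasure (Fin m → X)) : Prop :=
  S.extMarkov α = α ∧ ∀ β, S.extMarkov β = β → β = α

end Markov

/-- The law on symbols at the state `x`: the symbol `j` has probability `p_j (x)`. -/
noncomputable def symbolLaw (S : GIFSpdp X m n) (x : Fin m → X) : Measure (Fin n) :=
  ∑ j, ENNReal.ofReal (S.p j x) • Measure.dirac j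

instance (S : GIFSpdp X m n) (x : Fin m → X) : IsProbabilityMeasure (S.symbolLaw x) := by
  constructor
  simp [symbolLaw, S.sum_ofReal_p]

theorem symbolLaw_singleton (S : GIFSpdp X m n) (x : Fin m → X) (j : Fin n) :
    S.symbolLaw x {j} = ENNReal.ofReal (S.p j x) := by
  classical
  simp [symbolLaw, Set.indicator_apply]

/-- Some infinite word that starts with the given symbols `v_0, …, v_k`. -/
def extendWord {k : ℕ} (v : Finset.Iic k → Fin n) : ℕ → Fin n :=
  fun l => if h : l ≤ k then v ⟨l, Finset.mem_Iic.2 h⟩ else v ⟨0, Finset.mem_Iic.2 k.zero_le⟩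

/-- The law of the symbol `w_{k+1}` given `w_0, …, w_k`, when the orbit starts at `x`: it is
`j ↦ p_j (x_{k+1}, …, x_{k+m})`. -/
noncomputable def symbolKernel (S : GIFSpdp X m n) (x : Fin m → X) (k : ℕ) :
    Kernel (Finset.Iic k → Fin n) (Fin n) where
  toFun v := S.symbolLaw (S.block x (extendWord v) (k + 1))
  measurable' := Measurable.of_discrete

instance (S : GIFSpdp X m n) (x : Fin m → X) (k : ℕ) : IsMarkovKernel (S.symbolKernel x k) :=
  ⟨fun v => inferInstanceAs
    (IsProbabilityMeasure (S.symbolLaw (S.block x (extendWord v) (k + 1))))⟩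

/-- The probability `P_x` on the space of symbol sequences; it is determined by its values on
cylinders, see `symbolMeasure_cylinder`. -/
noncomputable def symbolMeasure (S : GIFSpdp X m n) (x : Fin m → X) : Measure (ℕ → Fin n) :=
  Kernel.trajMeasure (X := fun _ => Fin n) (S.symbolLaw x) (S.symbolKernel x)

instance (S : GIFSpdp X m n) (x : Fin m → X) : IsProbabilityMeasure (S.symbolMeasure x) :=
  inferInstanceAs (IsProbabilityMeasure
    (Kernel.trajMeasure (X := fun _ => Fin n) (S.symbolLaw x) (S.symbolKernel x)))

theorem symbolMeasure_map_zero (S : GIFSpdp X m n) (x : Fin m → X) :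
    (S.symbolMeasure x).map (fun w => w 0) = S.symbolLaw x := by
  have h : (fun w : ℕ → Fin n => w 0) =
      (fun v : Finset.Iic 0 → Fin n => v ⟨0, Finset.mem_Iic.2 le_rfl⟩) ∘
        Preorder.frestrictLe (π := fun _ => Fin n) 0 := rfl
  rw [h, ← Measure.map_map (by fun_prop) (by fun_prop), symbolMeasure, Kernel.trajMeasure,
    Measure.map_comp _ _ (by fun_prop), Kernel.traj_map_frestrictLe, Kernel.partialTraj_self,
    Measure.id_comp, Measure.map_map (by fun_prop) (by fun_prop)]
  exact Measure.map_id

/-- `P_x` of the cylinder of `w_0 ⋯ w_{k-1}` is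
`p_{w_0} (x_0, …, x_{m-1}) ⋯ p_{w_{k-1}} (x_{k-1}, …, x_{k+m-2})`. -/
theorem symbolMeasure_cylinder (S : GIFSpdp X m n) (x : Fin m → X) (w : ℕ → Fin n) (k : ℕ) :
    S.symbolMeasure x {v | ∀ l < k, v l = w l} =
      ∏ l ∈ Finset.range k, ENNReal.ofReal (S.p (w l) (S.block x w l)) := by
  induction k with
  | zero => simp
  | succ k ih =>
    cases k with
    | zero =>
      have h : {v : ℕ → Fin n | ∀ l < 0 + 1, v l = w l} = (fun v => v 0) ⁻¹' {w 0} := by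
        ext v
        simp
      rw [h, ← Measure.map_apply (by fun_prop) (measurableSet_singleton _),
        symbolMeasure_map_zero, symbolLaw_singleton]
      simp [block_zero]
    | succ a =>
      rw [Finset.prod_range_succ, ← ih]
      set r : (ℕ → Fin n) → (Finset.Iic a → Fin n) :=
        Preorder.frestrictLe (π := fun _ => Fin n) a with hr
      have hrm : Measurable r := by fun_prop
      have hset : {v : ℕ → Fin n | ∀ l < a + 1, v l = w l} = r ⁻¹' {r w} := by
        ext v
        simp only [Set.mem_ofPred_eq, Set.mem_preimage, Set.mem_singleton_iff, funext_iff]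
        exact ⟨fun h i => h i (Nat.lt_succ_of_le (Finset.mem_Iic.1 i.2)),
          fun h l hl => h ⟨l, Finset.mem_Iic.2 (Nat.le_of_lt_succ hl)⟩⟩
      have hset' : {v : ℕ → Fin n | ∀ l < a + 1 + 1, v l = w l} =
          (fun v => (r v, v (a + 1))) ⁻¹' ({r w} ×ˢ {w (a + 1)}) := by
        ext v
        have h := Set.ext_iff.1 hset v
        simp only [Set.mem_ofPred_eq, Set.mem_preimage, Set.mem_singleton_iff] at h
        simp only [Set.mem_ofPred_eq, Set.mem_preimage, Set.mem_prod, Set.mem_singleton_iff, ← h]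
        exact ⟨fun h => ⟨fun l hl => h l (by omega), h _ (by omega)⟩, fun h l hl => by
          rcases Nat.lt_succ_iff_lt_or_eq.1 hl with h' | h'
          · exact h.1 l h'
          · exact h' ▸ h.2⟩
      have key : (S.symbolMeasure x).map r ⊗ₘ S.symbolKernel x a =
          (S.symbolMeasure x).map (fun v => (r v, v (a + 1))) :=
        Kernel.map_frestrictLe_trajMeasure_compProd_eq_map_trajMeasure
          (X := fun _ => Fin n) (μ₀ := S.symbolLaw x) (κ := S.symbolKernel x)
      have hP : IsProbabilityMeasure ((S.symbolMeasure x).map r) :=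
        Measure.isProbabilityMeasure_map hrm.aemeasurable
      rw [hset', ← Measure.map_apply (by fun_prop)
        ((measurableSet_singleton _).prod (measurableSet_singleton _)), ← key,
        Measure.compProd_apply_prod (measurableSet_singleton _) (measurableSet_singleton _),
        Measure.restrict_singleton, lintegral_smul_measure, lintegral_dirac, hset,
        Measure.map_apply hrm (measurableSet_singleton _), smul_eq_mul]
      congr 1
      change S.symbolLaw (S.block x (extendWord (r w)) (a + 1)) {w (a + 1)} = _
      rw [symbolLaw_singleton, S.block_congr x (v := w) (a + 1)]
      intro l hl
      simp [extendWord, hr, Nat.le_of_lt_succ hl]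

end GIFSpdp

/-! Passing from points to blocks turns the orbit into a Markov chain on `X ^ m` driven by an
ordinary iterated function system, with transfer operator `B̂ = extTransfer`. The proof combines two
facts about this chain.

Mixing: `B̂^N g` converges uniformly to a constant. (E1) makes all `φ̂_j` contract one weighted
distance, and with the Lipschitz weights this bounds the modulus of continuity of `B̂^N g` uniformly
in `N`. Since every `p_j ≥ δ`, two starting points can both follow one fixed word with a definite
probability, which brings them close; hence the oscillation of `B̂^N g` tends to zero
(`exists_tendsto_iterate_extTransfer`). By duality the constant is the integral of `g` against any
fixed point, which gives uniqueness; compactness gives existence.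

Law of large numbers: the sums of `B̂ g (Z_k) - g (Z_{k+1})` over the blocks `Z_k` form a martingale
with bounded increments, so they are almost surely `o(K)` (`ae_tendsto_deviation_div`). Thus `g`,
`B̂ g`, `B̂² g`, … have asymptotically the same averages along the orbit, and these averages tend to
the constant (`tendsto_average_block`). Separability of `C(X, ℝ)` makes the exceptional null set
independent of `f`. -/

namespace GIFSpdp

variable {X : Type*} [MetricSpace X] {m n : ℕ}

/-! ### A common contracting distance -/

/-- A bounded weighted maximum distance, larger than the metric, that is contracted by all the maps
of the extension at once. -/
theorem exists_contracting_dist [CompactSpace X] (hm : 1 ≤ m) (S : GIFSpdp X m n) (h1 : S.E1) :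
    ∃ (ρ : ℝ) (D : (Fin m → X) → (Fin m → X) → ℝ) (Δ : ℝ), 0 ≤ ρ ∧ ρ < 1 ∧
      (∀ x y, dist x y ≤ D x y) ∧ (∀ x y, D x y ≤ Δ) ∧
      ∀ j x y, D (S.extMap j x) (S.extMap j y) ≤ ρ * D x y := by
  choose a ha hsum using h1
  -- Coordinate `i` will get weight `r ^ i` with `r > 1`. The shift of coordinates then gains `r⁻¹`,
  -- while the new last coordinate contracts by the factor `∑ i, a j i` and must absorb weights up
  -- to `r ^ m`, so `r` is taken close enough to `1`.
  have hev : ∀ᶠ r in 𝓝[>] (1 : ℝ), ∀ j, r ^ m * ∑ i, a j i < 1 := by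
    refine eventually_all.2 fun j => ?_
    have hc : Tendsto (fun r : ℝ => r ^ m * ∑ i, a j i) (𝓝 1) (𝓝 (1 ^ m * ∑ i, a j i)) :=
      Continuous.tendsto (by fun_prop) 1
    rw [one_pow, one_mul] at hc
    exact (hc.mono_left nhdsWithin_le_nhds).eventually_lt_const (hsum j)
  obtain ⟨r, hr, hr1⟩ := (hev.and self_mem_nhdsWithin).exists
  have hr1 : 1 < r := hr1
  have hr0 : 0 < r := zero_lt_one.trans hr1
  have : Nonempty (Fin m) := ⟨⟨0, hm⟩⟩
  let D : (Fin m → X) → (Fin m → X) → ℝ := fun x y => ⨆ i : Fin m, r ^ (i : ℕ) * dist (x i) (y i)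
  have hle : ∀ x y (i : Fin m), r ^ (i : ℕ) * dist (x i) (y i) ≤ D x y := fun x y i =>
    le_ciSup (f := fun i : Fin m => r ^ (i : ℕ) * dist (x i) (y i)) (Set.finite_range _).bddAbove i
  have hle' : ∀ x y i, dist (x i) (y i) ≤ D x y := fun x y i =>
    (le_mul_of_one_le_left dist_nonneg (one_le_pow₀ hr1.le)).trans (hle x y i)
  have hD0 : ∀ x y, 0 ≤ D x y := fun x y => dist_nonneg.trans (hle' x y ⟨0, hm⟩)
  refine ⟨r⁻¹, D, r ^ m * Metric.diam (Set.univ : Set X), by positivity,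
    inv_lt_one_of_one_lt₀ hr1, fun x y => (dist_pi_le_iff (hD0 x y)).2 (hle' x y),
    fun x y => ciSup_le fun i => ?_, fun j x y => ciSup_le fun i => ?_⟩
  · exact mul_le_mul (pow_le_pow_right₀ hr1.le i.2.le)
      (Metric.dist_le_diam_of_mem (Metric.isBounded_of_compactSpace) trivial trivial)
      dist_nonneg (by positivity)
  · unfold extMap
    split_ifs with h
    · have := hle x y ⟨i + 1, h⟩
      rw [inv_mul_eq_div, le_div_iff₀ hr0]
      simp only at this
      rw [pow_succ] at this
      linarith
    · have hi : (i : ℕ) + 1 = m := by omega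
      rw [inv_mul_eq_div, le_div_iff₀ hr0]
      have h2 : dist (S.φ j x) (S.φ j y) ≤ (∑ i, a j i) * D x y := by
        refine ((ha j).2 x y).trans ?_
        rw [Finset.sum_mul]
        exact Finset.sum_le_sum fun i _ => mul_le_mul_of_nonneg_left (hle' x y i) ((ha j).1 i).le
      calc r ^ (i : ℕ) * dist (S.φ j x) (S.φ j y) * r
          = r ^ m * dist (S.φ j x) (S.φ j y) := by
            rw [show r ^ m = r ^ (i : ℕ) * r by rw [← pow_succ, hi]]
            ring
        _ ≤ r ^ m * ((∑ i, a j i) * D x y) := by gcongr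
        _ = (r ^ m * ∑ i, a j i) * D x y := by ring
        _ ≤ D x y := mul_le_of_le_one_left (hD0 x y) (hr j).le

/-! ### Estimates for the transfer operator -/

theorem abs_p_sub_le (S : GIFSpdp X m n) (h2 : S.E2) (j : Fin n) (x y : Fin m → X) :
    |S.p j x - S.p j y| ≤ dist x y := by
  obtain ⟨c, hc, hs⟩ := h2.2 j
  calc |S.p j x - S.p j y| ≤ ∑ i, c i * dist (x i) (y i) := hc.2 x y
    _ ≤ ∑ i, c i * dist x y := Finset.sum_le_sum fun i _ =>
        mul_le_mul_of_nonneg_left (dist_le_pi_dist x y i) (hc.1 i).le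
    _ = (∑ i, c i) * dist x y := (Finset.sum_mul ..).symm
    _ ≤ dist x y := mul_le_of_le_one_left dist_nonneg hs.le

/-- Because the weights sum to `1`, bounds on `B̂ g` become sign statements about an average; with
`u = B̂ g x` it says that the martingale increments have mean zero. -/
theorem sub_extTransfer (S : GIFSpdp X m n) (g : C(Fin m → X, ℝ)) (u : ℝ) (x : Fin m → X) :
    u - S.extTransfer g x = ∑ j, S.p j x * (u - g (S.extMap j x)) := by
  simp only [mul_sub, Finset.sum_sub_distrib, ← Finset.sum_mul, S.p_sum, extTransfer_apply, one_mul]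

theorem extTransfer_neg (S : GIFSpdp X m n) (g : C(Fin m → X, ℝ)) :
    S.extTransfer (-g) = -S.extTransfer g := by
  ext x
  simp [extTransfer_apply]

theorem iterate_extTransfer_neg (S : GIFSpdp X m n) (g : C(Fin m → X, ℝ)) (k : ℕ) :
    S.extTransfer^[k] (-g) = -S.extTransfer^[k] g :=
  (Function.Commute.iterate_left (f := S.extTransfer) (g := fun g => -g)
    (fun g => S.extTransfer_neg g) k).eq g

theorem extTransfer_le (S : GIFSpdp X m n) {g : C(Fin m → X, ℝ)} {u : ℝ} (hu : ∀ x, g x ≤ u)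
    (x : Fin m → X) : S.extTransfer g x ≤ u := by
  have h := S.sub_extTransfer g u x
  have : 0 ≤ ∑ j, S.p j x * (u - g (S.extMap j x)) :=
    Finset.sum_nonneg fun j _ => mul_nonneg (S.p_mem j x).1 (sub_nonneg.2 (hu _))
  linarith

theorem le_extTransfer (S : GIFSpdp X m n) {g : C(Fin m → X, ℝ)} {l : ℝ} (hl : ∀ x, l ≤ g x)
    (x : Fin m → X) : l ≤ S.extTransfer g x := by
  have h := S.extTransfer_le (g := -g) (u := -l) (fun x => neg_le_neg (hl x)) x
  rw [extTransfer_neg] at h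
  exact neg_le_neg_iff.1 h

/-- The symbol `j` carries mass at least `δ`; all remaining mass is estimated by the upper bound
`u`. -/
theorem extTransfer_le_interpolate (S : GIFSpdp X m n) {g : C(Fin m → X, ℝ)} {u δ : ℝ}
    (hu : ∀ x, g x ≤ u) (j : Fin n) (x : Fin m → X) (hδ : δ ≤ S.p j x) :
    S.extTransfer g x ≤ (1 - δ) * u + δ * g (S.extMap j x) := by
  have h := S.sub_extTransfer g u x
  have h1 : S.p j x * (u - g (S.extMap j x)) ≤ ∑ j, S.p j x * (u - g (S.extMap j x)) :=
    Finset.single_le_sum (f := fun j => S.p j x * (u - g (S.extMap j x)))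
      (fun j _ => mul_nonneg (S.p_mem j x).1 (sub_nonneg.2 (hu _))) (Finset.mem_univ j)
  have h2 := mul_le_mul_of_nonneg_right hδ (sub_nonneg.2 (hu (S.extMap j x)))
  linarith

/-- The constant word `j ⋯ j` of length `k` has probability at least `δ ^ k` from every starting
point. -/
theorem iterate_extTransfer_le_interpolate (S : GIFSpdp X m n) {u δ : ℝ} (j : Fin n)
    (hδ0 : 0 ≤ δ) (hδ : ∀ x, δ ≤ S.p j x) (k : ℕ) {g : C(Fin m → X, ℝ)} (hu : ∀ x, g x ≤ u)
    (x : Fin m → X) :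
    S.extTransfer^[k] g x ≤ (1 - δ ^ k) * u + δ ^ k * g ((S.extMap j)^[k] x) := by
  induction k generalizing g with
  | zero => simp
  | succ k ih =>
    rw [Function.iterate_succ_apply, Function.iterate_succ_apply']
    refine (ih (S.extTransfer_le hu)).trans ?_
    have := mul_le_mul_of_nonneg_left
      (S.extTransfer_le_interpolate hu j ((S.extMap j)^[k] x) (hδ _)) (pow_nonneg hδ0 k)
    rw [pow_succ]
    linarith

theorem interpolate_le_iterate_extTransfer (S : GIFSpdp X m n) {l δ : ℝ} (j : Fin n)
    (hδ0 : 0 ≤ δ) (hδ : ∀ x, δ ≤ S.p j x) (k : ℕ) {g : C(Fin m → X, ℝ)} (hl : ∀ x, l ≤ g x)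
    (x : Fin m → X) :
    (1 - δ ^ k) * l + δ ^ k * g ((S.extMap j)^[k] x) ≤ S.extTransfer^[k] g x := by
  have h := S.iterate_extTransfer_le_interpolate j hδ0 hδ k (g := -g) (u := -l)
    (fun x => neg_le_neg (hl x)) x
  rw [iterate_extTransfer_neg] at h
  simp only [ContinuousMap.neg_apply] at h
  linarith

/-- The transfer operator improves the slope `M` of a modulus of continuity `ε + M * D`, up to a
multiple of the oscillation. -/
theorem extTransfer_sub_le (S : GIFSpdp X m n) {D : (Fin m → X) → (Fin m → X) → ℝ}
    {ρ ε M l u : ℝ} (hM : 0 ≤ M)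
    (hD : ∀ j x y, D (S.extMap j x) (S.extMap j y) ≤ ρ * D x y)
    (hp : ∀ j x y, |S.p j x - S.p j y| ≤ D x y) {g : C(Fin m → X, ℝ)}
    (hl : ∀ x, l ≤ g x) (hu : ∀ x, g x ≤ u) (hg : ∀ x y, g x - g y ≤ ε + M * D x y)
    (x y : Fin m → X) :
    S.extTransfer g x - S.extTransfer g y ≤ ε + (ρ * M + n * (u - l)) * D x y := by
  -- The first sum moves the point under fixed weights, the second changes the weights. Subtracting
  -- `l` in the second is free since the weight differences sum to zero, and it leaves factors in
  -- `[0, u - l]`.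
  have h1 : S.extTransfer g x - S.extTransfer g y =
      (∑ j, S.p j x * (g (S.extMap j x) - g (S.extMap j y))) +
        ∑ j, (S.p j x - S.p j y) * (g (S.extMap j y) - l) := by
    simp only [extTransfer_apply, mul_sub, sub_mul, Finset.sum_sub_distrib, ← Finset.sum_mul,
      S.p_sum]
    ring
  have h2 : ∑ j, S.p j x * (g (S.extMap j x) - g (S.extMap j y)) ≤ ε + M * (ρ * D x y) := by
    calc _ ≤ ∑ j, S.p j x * (ε + M * (ρ * D x y)) := Finset.sum_le_sum fun j _ =>
          mul_le_mul_of_nonneg_left ((hg _ _).trans (by gcongr; exact hD j x y)) (S.p_mem j x).1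
      _ = _ := by rw [← Finset.sum_mul, S.p_sum, one_mul]
  have h3 : ∑ j, (S.p j x - S.p j y) * (g (S.extMap j y) - l) ≤ n * (D x y * (u - l)) := by
    calc _ ≤ ∑ _j : Fin n, D x y * (u - l) := Finset.sum_le_sum fun j _ =>
          mul_le_mul ((le_abs_self _).trans (hp j x y)) (sub_le_sub_right (hu _) _)
            (sub_nonneg.2 (hl _)) ((abs_nonneg _).trans (hp j x y))
      _ = _ := by simp
  rw [h1]
  linarith

theorem iterate_extTransfer_bounds (S : GIFSpdp X m n) {g : C(Fin m → X, ℝ)} {l u : ℝ}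
    (hl : ∀ x, l ≤ g x) (hu : ∀ x, g x ≤ u) (N : ℕ) (x : Fin m → X) :
    l ≤ S.extTransfer^[N] g x ∧ S.extTransfer^[N] g x ≤ u := by
  induction N generalizing x with
  | zero => exact ⟨hl x, hu x⟩
  | succ N ih =>
    rw [Function.iterate_succ_apply']
    exact ⟨S.le_extTransfer (fun x => (ih x).1) x, S.extTransfer_le (fun x => (ih x).2) x⟩

/-- The iterates of the transfer operator are equicontinuous on each continuous function. -/
theorem exists_iterate_extTransfer_sub_le (S : GIFSpdp X m n)
    {D : (Fin m → X) → (Fin m → X) → ℝ} {ρ ε M l u : ℝ} (hρ : ρ < 1)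
    (hD : ∀ j x y, D (S.extMap j x) (S.extMap j y) ≤ ρ * D x y)
    (hp : ∀ j x y, |S.p j x - S.p j y| ≤ D x y) {g : C(Fin m → X, ℝ)} (hD0 : ∀ x y, 0 ≤ D x y)
    (hl : ∀ x, l ≤ g x) (hu : ∀ x, g x ≤ u) (hM : 0 ≤ M)
    (hg : ∀ x y, g x - g y ≤ ε + M * D x y) :
    ∃ M', 0 ≤ M' ∧ ∀ N x y, S.extTransfer^[N] g x - S.extTransfer^[N] g y ≤ ε + M' * D x y := by
  -- The second entry of the maximum is the fixed point of the slope recursion `M ↦ ρ * M + n * (u -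
  -- l)`, so the maximum is not increased by it.
  have hM' : ρ * max M (n * (u - l) / (1 - ρ)) + n * (u - l) ≤ max M (n * (u - l) / (1 - ρ)) := by
    have := le_max_right M (n * (u - l) / (1 - ρ))
    rw [div_le_iff₀ (sub_pos.2 hρ)] at this
    linarith
  refine ⟨_, hM.trans (le_max_left M (n * (u - l) / (1 - ρ))), fun N => ?_⟩
  induction N with
  | zero =>
    intro x y
    refine (hg x y).trans ?_
    gcongr
    · exact hD0 x y
    · exact le_max_left _ _
  | succ N ih =>
    intro x y
    rw [Function.iterate_succ_apply']
    refine (S.extTransfer_sub_le (hM.trans (le_max_left _ _)) hD hp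
      (fun x => (S.iterate_extTransfer_bounds hl hu N x).1)
      (fun x => (S.iterate_extTransfer_bounds hl hu N x).2) ih x y).trans ?_
    gcongr
    exact hD0 x y

end GIFSpdp

/-! ### Uniform convergence of the iterates to a constant -/

/-- A uniformly continuous bounded function has, for each `ε > 0`, the modulus `ε + M * dist`. -/
theorem ContinuousMap.exists_sub_le_add_mul_dist {Y : Type*} [PseudoMetricSpace Y] [CompactSpace Y]
    (g : C(Y, ℝ)) {ε : ℝ} (hε : 0 < ε) :
    ∃ M, 0 ≤ M ∧ ∀ x y, g x - g y ≤ ε + M * dist x y := by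
  obtain ⟨η, hη, h⟩ := Metric.uniformContinuous_iff.1
    (CompactSpace.uniformContinuous_of_continuous g.continuous) ε hε
  refine ⟨2 * ‖g‖ / η, by positivity, fun x y => ?_⟩
  by_cases hxy : dist x y < η
  · have := (le_abs_self _).trans (h hxy).le
    have : 0 ≤ 2 * ‖g‖ / η * dist x y := by positivity
    linarith
  · have h1 : 2 * ‖g‖ ≤ 2 * ‖g‖ / η * dist x y := by
      rw [div_mul_eq_mul_div, le_div_iff₀ hη]
      exact mul_le_mul_of_nonneg_left (not_lt.1 hxy) (by positivity)
    have := (abs_le.1 (g.norm_coe_le_norm x)).2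
    have := (abs_le.1 (g.norm_coe_le_norm y)).1
    linarith

namespace GIFSpdp

variable {X : Type*} [MetricSpace X] [Nonempty X] {m n : ℕ}

theorem nonempty_symbols (S : GIFSpdp X m n) : Nonempty (Fin n) := by
  by_contra h
  rw [not_nonempty_iff] at h
  simpa using S.p_sum (fun _ => Classical.arbitrary X)

/-- The iterates of the transfer operator converge uniformly to a constant. -/
theorem exists_tendsto_iterate_extTransfer [CompactSpace X] (hm : 1 ≤ m) (S : GIFSpdp X m n)
    (h1 : S.E1) (h2 : S.E2) (g : C(Fin m → X, ℝ)) :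
    ∃ c : ℝ, Tendsto (fun N => S.extTransfer^[N] g) atTop (𝓝 (ContinuousMap.const _ c)) := by
  obtain ⟨ρ, D, Δ, hρ0, hρ1, hdist, hΔ, hD⟩ := S.exists_contracting_dist hm h1
  obtain ⟨j⟩ := S.nonempty_symbols
  obtain ⟨δ, hδ, hpδ⟩ := h2.1
  have hD0 : ∀ x y, 0 ≤ D x y := fun x y => dist_nonneg.trans (hdist x y)
  set G : ℕ → C(Fin m → X, ℝ) := fun N => S.extTransfer^[N] g with hG
  have hba : ∀ N, BddAbove (Set.range (G N)) := fun N => (isCompact_range (G N).continuous).bddAbove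
  have hbb : ∀ N, BddBelow (Set.range (G N)) := fun N => (isCompact_range (G N).continuous).bddBelow
  set u : ℕ → ℝ := fun N => ⨆ x, G N x
  set l : ℕ → ℝ := fun N => ⨅ x, G N x
  have hGu : ∀ N x, G N x ≤ u N := fun N x => le_ciSup (hba N) x
  have hlG : ∀ N x, l N ≤ G N x := fun N x => ciInf_le (hbb N) x
  have hlu : ∀ N, l N ≤ u N := fun N => by
    have x : Fin m → X := fun _ => Classical.arbitrary X
    exact (hlG N x).trans (hGu N x)
  have hGs : ∀ N, G (N + 1) = S.extTransfer (G N) := fun N => Function.iterate_succ_apply' ..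
  have huanti : Antitone u := antitone_nat_of_succ_le fun N => ciSup_le fun x => by
    rw [hGs]
    exact S.extTransfer_le (hGu N) x
  have hlmono : Monotone l := monotone_nat_of_le_succ fun N => le_ciInf fun x => by
    rw [hGs]
    exact S.le_extTransfer (hlG N) x
  have hut := tendsto_atTop_ciInf huanti
    ⟨l 0, by rintro _ ⟨N, rfl⟩; exact (hlmono N.zero_le).trans (hlu N)⟩
  have hlt := tendsto_atTop_ciSup hlmono
    ⟨u 0, by rintro _ ⟨N, rfl⟩; exact (hlu N).trans (huanti N.zero_le)⟩
  set U := ⨅ N, u N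
  set L := ⨆ N, l N
  have hLU : L ≤ U := le_of_tendsto_of_tendsto' hlt hut hlu
  -- If the limit oscillation `U - L` were positive, a modulus `(U - L) / 4 + M' * D` valid for all
  -- `N` and a `k` with `M' * ρ ^ k * Δ ≤ (U - L) / 4` would make any `G N` vary by at most `(U - L)
  -- / 2` on the image of the word `j ⋯ j` of length `k`.
  have hUL : U = L := by
    by_contra hne
    have hω : 0 < U - L := sub_pos.2 (lt_of_le_of_ne hLU (Ne.symm hne))
    obtain ⟨M, hM0, hM⟩ := g.exists_sub_le_add_mul_dist (ε := (U - L) / 4) (by linarith)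
    obtain ⟨M', hM'0, hM'⟩ := S.exists_iterate_extTransfer_sub_le hρ1 hD
      (fun j x y => (S.abs_p_sub_le h2 j x y).trans (hdist x y)) hD0 (hlG 0) (hGu 0) hM0
      (fun x y => (hM x y).trans (by gcongr; exact hdist x y))
    have hk : Tendsto (fun k : ℕ => M' * (ρ ^ k * Δ)) atTop (𝓝 (M' * (0 * Δ))) :=
      ((tendsto_pow_atTop_nhds_zero_of_lt_one hρ0 hρ1).mul_const _).const_mul _
    obtain ⟨k, hk⟩ := (hk.eventually_le_const (u := (U - L) / 4) (by simp; linarith)).exists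
    have hiter : ∀ (k : ℕ) x y, D ((S.extMap j)^[k] x) ((S.extMap j)^[k] y) ≤ ρ ^ k * Δ := by
      intro k x y
      induction k with
      | zero => simpa using hΔ x y
      | succ k ih =>
        rw [Function.iterate_succ_apply', Function.iterate_succ_apply', pow_succ', mul_assoc]
        exact (hD _ _ _).trans (mul_le_mul_of_nonneg_left ih hρ0)
    have hstep : ∀ N, u (N + k) - l (N + k) ≤
        (1 - δ ^ k) * (u N - l N) + δ ^ k * ((U - L) / 2) := by
      intro N
      have hGk : G (N + k) = S.extTransfer^[k] (G N) := by
        rw [hG]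
        simp only
        rw [add_comm, Function.iterate_add_apply]
      have hxy : ∀ x y, G (N + k) x - G (N + k) y ≤
          (1 - δ ^ k) * (u N - l N) + δ ^ k * ((U - L) / 2) := by
        intro x y
        have e1 := S.iterate_extTransfer_le_interpolate j hδ.le (hpδ j) k (hGu N) x
        have e2 := S.interpolate_le_iterate_extTransfer j hδ.le (hpδ j) k (hlG N) y
        have e3 : G N ((S.extMap j)^[k] x) - G N ((S.extMap j)^[k] y) ≤ (U - L) / 2 := by
          have : G N ((S.extMap j)^[k] x) - G N ((S.extMap j)^[k] y) ≤ _ :=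
            hM' N ((S.extMap j)^[k] x) ((S.extMap j)^[k] y)
          have := mul_le_mul_of_nonneg_left (hiter k x y) hM'0
          linarith
        have e4 := mul_le_mul_of_nonneg_left e3 (pow_nonneg hδ.le k)
        rw [hGk]
        linarith
      have : ∀ y, u (N + k) ≤
          G (N + k) y + ((1 - δ ^ k) * (u N - l N) + δ ^ k * ((U - L) / 2)) :=
        fun y => ciSup_le fun x => by linarith [hxy x y]
      have : u (N + k) - ((1 - δ ^ k) * (u N - l N) + δ ^ k * ((U - L) / 2)) ≤ l (N + k) :=
        le_ciInf fun y => by linarith [this y]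
      linarith
    -- As `N → ∞` this forces `U - L ≤ (1 - δ ^ k / 2) * (U - L)`, which is absurd.
    have hlim := le_of_tendsto_of_tendsto'
      ((hut.comp (tendsto_add_atTop_nat k)).sub (hlt.comp (tendsto_add_atTop_nat k)))
      (((hut.sub hlt).const_mul (1 - δ ^ k)).add_const (δ ^ k * ((U - L) / 2))) hstep
    have := mul_pos (pow_pos hδ k) hω
    linarith
  refine ⟨L, ?_⟩
  rw [hUL] at hut
  rw [ContinuousMap.tendsto_iff_tendstoUniformly, Metric.tendstoUniformly_iff]
  intro ε hε
  filter_upwards [hut.eventually_lt_const (lt_add_of_pos_right L hε),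
    hlt.eventually_const_lt (sub_lt_self L hε)] with N hN1 hN2 x
  have := hGu N x
  have := hlG N x
  rw [ContinuousMap.const_apply, Real.dist_eq, abs_lt]
  constructor <;> linarith

end GIFSpdp

/-! ### The extended Hutchinson measure and its marginals -/

/-- Uniform convergence to a constant entails convergence of the integrals. -/
theorem ContinuousMap.tendsto_integral_of_tendsto_const {Y ι : Type*} [TopologicalSpace Y]
    [CompactSpace Y] [MeasurableSpace Y] [OpensMeasurableSpace Y] (β : Measure Y)
    [IsProbabilityMeasure β] {F : Filter ι} {G : ι → C(Y, ℝ)} {c : ℝ}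
    (h : Tendsto G F (𝓝 (ContinuousMap.const Y c))) :
    Tendsto (fun i => ∫ y, G i y ∂β) F (𝓝 c) := by
  rw [tendsto_iff_norm_sub_tendsto_zero] at h ⊢
  refine squeeze_zero (fun _ => norm_nonneg _) (fun i => ?_) h
  have hint : Integrable (fun y => G i y) β :=
    (G i).continuous.integrable_of_hasCompactSupport (HasCompactSupport.of_compactSpace _)
  have h1 : (∫ y, G i y ∂β) - c = ∫ y, (G i - ContinuousMap.const Y c) y ∂β := by
    simp only [ContinuousMap.sub_apply, ContinuousMap.const_apply]
    rw [integral_sub hint (integrable_const c)]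
    simp
  rw [h1]
  simpa using norm_integral_le_of_norm_le_const (μ := β)
    (Eventually.of_forall (G i - ContinuousMap.const Y c).norm_coe_le_norm)

theorem MeasureTheory.Measure.ext_of_forall_integral_continuousMap_eq {Y : Type*}
    [TopologicalSpace Y] [CompactSpace Y] [HasOuterApproxClosed Y] [MeasurableSpace Y]
    [BorelSpace Y] {μ ν : Measure Y} [IsFiniteMeasure μ] [IsFiniteMeasure ν]
    (h : ∀ g : C(Y, ℝ), ∫ y, g y ∂μ = ∫ y, g y ∂ν) : μ = ν :=
  ext_of_forall_integral_eq_of_IsFiniteMeasure fun g => h g.toContinuousMap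

namespace GIFSpdp

variable {X : Type*} [MetricSpace X] [CompactSpace X] [MeasurableSpace X] [BorelSpace X] {m n : ℕ}

theorem integral_iterate_extMarkov (S : GIFSpdp X m n) (N : ℕ)
    (α : ProbabilityMeasure (Fin m → X)) (g : C(Fin m → X, ℝ)) :
    ∫ x, g x ∂(S.extMarkov^[N] α : Measure (Fin m → X)) =
      ∫ x, S.extTransfer^[N] g x ∂(α : Measure (Fin m → X)) := by
  induction N generalizing α with
  | zero => rfl
  | succ N ih =>
    rw [Function.iterate_succ_apply, ih, integral_extMarkov, Function.iterate_succ_apply']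

/-- The extended Hutchinson measure exists, and the iterates of the transfer operator converge
uniformly to the integral against it. -/
theorem exists_isExtendedHutchinson [Nonempty X] (hm : 1 ≤ m) (S : GIFSpdp X m n) (h1 : S.E1)
    (h2 : S.E2) :
    ∃ α : ProbabilityMeasure (Fin m → X), S.IsExtendedHutchinson α ∧
      ∀ g, Tendsto (fun N => S.extTransfer^[N] g) atTop
        (𝓝 (ContinuousMap.const _ (∫ x, g x ∂(α : Measure (Fin m → X))))) := by
  choose c hc using S.exists_tendsto_iterate_extTransfer hm h1 h2
  let β : ProbabilityMeasure (Fin m → X) :=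
    ⟨Measure.dirac fun _ => Classical.arbitrary X, inferInstance⟩
  -- Compactness of the space of probability measures gives a limit of the iterates along an
  -- ultrafilter; its integrals must be the constants `c g`.
  let F : Ultrafilter ℕ := Ultrafilter.of atTop
  have hF : (F : Filter ℕ) ≤ atTop := Ultrafilter.of_le atTop
  let V : Ultrafilter (ProbabilityMeasure (Fin m → X)) := F.map fun N => S.extMarkov^[N] β
  let α := V.lim
  have hα : Tendsto (fun N => S.extMarkov^[N] β) F (𝓝 α) := V.le_nhds_lim
  have hint : ∀ g : C(Fin m → X, ℝ), ∫ x, g x ∂(α : Measure (Fin m → X)) = c g := fun g => by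
    have e1 := ProbabilityMeasure.tendsto_iff_forall_integral_tendsto.1 hα
      (BoundedContinuousFunction.mkOfCompact g)
    simp only [BoundedContinuousFunction.mkOfCompact_apply, integral_iterate_extMarkov] at e1
    exact tendsto_nhds_unique e1
      ((ContinuousMap.tendsto_integral_of_tendsto_const _ (hc g)).mono_left hF)
  have hext : ∀ β γ : ProbabilityMeasure (Fin m → X), (∀ g : C(Fin m → X, ℝ),
      ∫ x, g x ∂(β : Measure (Fin m → X)) = ∫ x, g x ∂(γ : Measure (Fin m → X))) → β = γ :=
    fun β γ h => Subtype.ext (Measure.ext_of_forall_integral_continuousMap_eq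
      (μ := (β : Measure (Fin m → X))) (ν := (γ : Measure (Fin m → X))) h)
  refine ⟨α, ⟨?_, fun β hβ => ?_⟩, fun g => by rw [hint]; exact hc g⟩
  · refine hext _ _ fun g => ?_
    rw [integral_extMarkov, hint, hint]
    -- Invariance amounts to `c (B̂ g) = c g`: the iterates of `B̂ g` are the shifted iterates of
    -- `g`.
    have e1 := (hc g).comp (tendsto_add_atTop_nat 1)
    have e2 := tendsto_nhds_unique e1 (hc (S.extTransfer g))
    exact (congrArg (fun h : C(Fin m → X, ℝ) => h fun _ => Classical.arbitrary X) e2).symm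
  · refine hext _ _ fun g => ?_
    rw [hint]
    refine tendsto_nhds_unique (f := fun _ : ℕ => ∫ x, g x ∂(β : Measure (Fin m → X)))
      (l := atTop) tendsto_const_nhds ?_
    have e1 := ContinuousMap.tendsto_integral_of_tendsto_const (β : Measure (Fin m → X)) (hc g)
    refine e1.congr fun N => ?_
    rw [← integral_iterate_extMarkov, Function.iterate_fixed hβ]

/-- The marginals of a fixed point of the Markov operator agree. -/
theorem map_eval_eq_of_extMarkov_eq (S : GIFSpdp X m n) {α : ProbabilityMeasure (Fin m → X)}
    (hα : S.extMarkov α = α) (hm : 0 < m) (i : Fin m) :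
    (α : Measure (Fin m → X)).map (fun z => z i) =
      (α : Measure (Fin m → X)).map (fun z => z ⟨0, hm⟩) := by
  obtain ⟨i, hi⟩ := i
  induction i with
  | zero => rfl
  | succ i ih =>
    rw [← ih (by omega)]
    have hP : ∀ k : Fin m, IsProbabilityMeasure ((α : Measure (Fin m → X)).map fun z => z k) :=
      fun k => Measure.isProbabilityMeasure_map (measurable_pi_apply k).aemeasurable
    refine Measure.ext_of_forall_integral_continuousMap_eq fun f => ?_
    rw [integral_map (measurable_pi_apply _).aemeasurable f.continuous.aestronglyMeasurable,
      integral_map (measurable_pi_apply _).aemeasurable f.continuous.aestronglyMeasurable]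
    -- Every `φ̂_j` moves coordinate `i + 1` to coordinate `i`, so `B̂ g` is `f` of coordinate `i +
    -- 1`, whatever the weights.
    let g : C(Fin m → X, ℝ) := f.comp ⟨fun z => z ⟨i, by omega⟩, by fun_prop⟩
    have h := S.integral_extMarkov α g
    rw [hα] at h
    refine Eq.trans ?_ h.symm
    congr 1
    funext z
    simp [extTransfer_apply, g, extMap, hi, ← Finset.sum_mul, S.p_sum]

end GIFSpdp

/-! ### A strong law from second moments -/

/-- A law of large numbers: a process with bounded increments and second moments that grow at most
linearly is almost surely sublinear. -/
theorem MeasureTheory.ae_tendsto_div_of_integral_sq_le {Ω : Type*} [MeasurableSpace Ω]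
    {P : Measure Ω} {M : ℕ → Ω → ℝ} {C C' : ℝ} (hmeas : ∀ K, Measurable (M K))
    (hinc : ∀ K ω, |M (K + 1) ω - M K ω| ≤ C) (hint : ∀ K, Integrable (fun ω => M K ω ^ 2) P)
    (hsq : ∀ K : ℕ, ∫ ω, M K ω ^ 2 ∂P ≤ C' * K) :
    ∀ᵐ ω ∂P, Tendsto (fun K : ℕ => M K ω / K) atTop (𝓝 0) := by
  have hsum : Summable fun N : ℕ => C' / ((N : ℝ) + 1) ^ 2 := by
    have := (summable_nat_add_iff 1).2 (Real.summable_one_div_nat_pow.2 one_lt_two)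
    simpa [div_eq_mul_inv] using this.mul_left C'
  -- Along the squares the second moments of `M K / K` are at most `C' / (N + 1) ^ 2`, hence
  -- summable. The shift to `N + 1` avoids division by zero.
  have hfin : ∫⁻ ω, ∑' N : ℕ, ENNReal.ofReal ((M ((N + 1) ^ 2) ω / ((N : ℝ) + 1) ^ 2) ^ 2) ∂P
      ≠ ∞ := by
    rw [lintegral_tsum fun N => (((hmeas _).div_const _).pow_const 2).ennreal_ofReal.aemeasurable]
    refine ne_top_of_le_ne_top hsum.tsum_ofReal_ne_top (ENNReal.tsum_le_tsum fun N => ?_)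
    have hpos : (0 : ℝ) < (N : ℝ) + 1 := by positivity
    simp only [div_pow]
    rw [← ofReal_integral_eq_lintegral_ofReal ((hint _).div_const _)
      (Eventually.of_forall fun ω => by positivity), integral_div]
    refine ENNReal.ofReal_le_ofReal ?_
    have h := hsq ((N + 1) ^ 2)
    rw [div_le_div_iff₀ (by positivity) (by positivity)]
    push_cast at h
    calc _ ≤ C' * ((N : ℝ) + 1) ^ 2 * ((N : ℝ) + 1) ^ 2 := by gcongr
      _ = _ := by ring
  have hlt := ae_lt_top' (AEMeasurable.tsum fun N =>
    (((hmeas ((N + 1) ^ 2)).div_const (((N : ℝ) + 1) ^ 2)).pow_const 2).ennreal_ofReal.aemeasurable)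
    hfin
  filter_upwards [hlt] with ω hω
  have hC : 0 ≤ C := (abs_nonneg _).trans (hinc 0 ω)
  have hsub : Tendsto (fun N : ℕ => |M (N ^ 2) ω / (N : ℝ) ^ 2|) atTop (𝓝 0) := by
    rw [← tendsto_add_atTop_iff_nat 1]
    have h1 := ENNReal.tendsto_atTop_zero_of_tsum_ne_top hω.ne
    have h2 := (ENNReal.tendsto_toReal ENNReal.zero_ne_top).comp h1
    have h3 := h2.sqrt
    simp only [ENNReal.toReal_zero, Real.sqrt_zero] at h3
    refine h3.congr fun N => ?_
    simp only [Function.comp]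
    rw [ENNReal.toReal_ofReal (sq_nonneg _), Real.sqrt_sq_eq_abs]
    push_cast
    rfl
  have hlip : ∀ a b : ℕ, |M (a + b) ω| ≤ |M a ω| + C * b := by
    intro a b
    induction b with
    | zero => simp
    | succ b ih =>
      have h1 := hinc (a + b) ω
      have h2 := abs_sub_abs_le_abs_sub (M (a + b + 1) ω) (M (a + b) ω)
      rw [← add_assoc]
      push_cast
      linarith
  have hbound : Tendsto (fun N : ℕ => |M (N ^ 2) ω / (N : ℝ) ^ 2| + 2 * C / N) atTop (𝓝 0) := by
    simpa using hsub.add (tendsto_const_div_atTop_nhds_zero_nat (2 * C))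
  have hsqrt : Tendsto Nat.sqrt atTop atTop :=
    tendsto_atTop.2 fun b => (eventually_ge_atTop (b ^ 2)).mono fun _ => Nat.le_sqrt'.2
  -- With `N = Nat.sqrt K`, the time from `N ^ 2` to `K` is at most `2 * N`, so bounded increments
  -- change `M` by at most `2 * C * N`, negligible against `N ^ 2`.
  refine squeeze_zero_norm' ?_ (hbound.comp hsqrt)
  filter_upwards [eventually_ge_atTop 1] with K hK
  have hN : 0 < Nat.sqrt K := Nat.sqrt_pos.2 hK
  have h1 : Nat.sqrt K ^ 2 ≤ K := Nat.sqrt_le' K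
  have h2 : K ≤ Nat.sqrt K * Nat.sqrt K + Nat.sqrt K + Nat.sqrt K := Nat.sqrt_le_add K
  simp only [Function.comp]
  set N := Nat.sqrt K
  obtain ⟨b, hb⟩ := Nat.exists_eq_add_of_le h1
  have hbN : (b : ℝ) ≤ 2 * N := by
    have : b ≤ 2 * N := by nlinarith
    exact_mod_cast this
  have hN' : (0 : ℝ) < N := by exact_mod_cast hN
  have hNK : (N : ℝ) ^ 2 ≤ K := by exact_mod_cast h1
  rw [norm_div, Real.norm_natCast, Real.norm_eq_abs, abs_div, abs_of_pos (pow_pos hN' 2)]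
  calc |M K ω| / K ≤ |M K ω| / (N : ℝ) ^ 2 := by gcongr
    _ ≤ (|M (N ^ 2) ω| + C * (2 * N)) / (N : ℝ) ^ 2 := by
        gcongr
        rw [hb]
        exact (hlip _ _).trans (by gcongr)
    _ = |M (N ^ 2) ω| / (N : ℝ) ^ 2 + 2 * C / N := by
        field_simp

/-! ### The martingale along the block process -/

namespace GIFSpdp

variable {X : Type*} [MetricSpace X] {m n : ℕ}

theorem integral_symbolLaw (S : GIFSpdp X m n) (x : Fin m → X) (h : Fin n → ℝ) :
    ∫ j, h j ∂(S.symbolLaw x) = ∑ j, S.p j x * h j := by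
  rw [integral_fintype .of_finite]
  refine Finset.sum_congr rfl fun j _ => ?_
  rw [measureReal_def, symbolLaw_singleton, ENNReal.toReal_ofReal (S.p_mem j x).1, smul_eq_mul]

theorem block_extendWord (S : GIFSpdp X m n) (x : Fin m → X) (w : ℕ → Fin n) {a k : ℕ}
    (hk : k ≤ a + 1) :
    S.block x (extendWord (Preorder.frestrictLe (π := fun _ => Fin n) a w)) k = S.block x w k :=
  S.block_congr x k fun l hl => by simp [extendWord, show l ≤ a by omega]

/-- The block at time `k` depends on finitely many symbols from a finite alphabet, so no regularity
of `g` is needed. -/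
theorem measurable_comp_block (S : GIFSpdp X m n) (x : Fin m → X) (k : ℕ)
    (g : (Fin m → X) → ℝ) : Measurable fun w : ℕ → Fin n => g (S.block x w k) := by
  have h : (fun w : ℕ → Fin n => g (S.block x w k)) =
      (fun v : Finset.Iic k → Fin n => g (S.block x (extendWord v) k)) ∘
        Preorder.frestrictLe (π := fun _ => Fin n) k := by
    funext w
    simp only [Function.comp]
    rw [S.block_extendWord x w (by omega)]
  rw [h]
  exact Measurable.of_discrete.comp (by fun_prop)

/-- The Markov property of the block process under the symbol measure. -/
theorem integral_mul_extTransfer_sub (S : GIFSpdp X m n) (x : Fin m → X) (g : C(Fin m → X, ℝ))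
    (a : ℕ) (H : (Finset.Iic a → Fin n) → ℝ) :
    ∫ w, H (Preorder.frestrictLe (π := fun _ => Fin n) a w) *
      (S.extTransfer g (S.block x w (a + 1)) - g (S.block x w (a + 2))) ∂(S.symbolMeasure x) = 0 := by
  set r : (ℕ → Fin n) → (Finset.Iic a → Fin n) :=
    Preorder.frestrictLe (π := fun _ => Fin n) a with hr
  have hrm : Measurable r := by fun_prop
  have key : (S.symbolMeasure x).map r ⊗ₘ S.symbolKernel x a =
      (S.symbolMeasure x).map (fun v => (r v, v (a + 1))) :=
    Kernel.map_frestrictLe_trajMeasure_compProd_eq_map_trajMeasure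
      (X := fun _ => Fin n) (μ₀ := S.symbolLaw x) (κ := S.symbolKernel x)
  have hP : IsProbabilityMeasure ((S.symbolMeasure x).map r) :=
    Measure.isProbabilityMeasure_map hrm.aemeasurable
  let Z : (Finset.Iic a → Fin n) → Fin m → X := fun v => S.block x (extendWord v) (a + 1)
  let Φ : (Finset.Iic a → Fin n) × Fin n → ℝ := fun q =>
    H q.1 * (S.extTransfer g (Z q.1) - g (S.extMap q.2 (Z q.1)))
  have h1 : ∀ w, H (r w) * (S.extTransfer g (S.block x w (a + 1)) - g (S.block x w (a + 2))) =
      Φ (r w, w (a + 1)) := fun w => by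
    simp only [Φ, Z, hr]
    rw [S.block_extendWord x w le_rfl, ← block_succ]
  simp only [h1]
  -- The joint law of `w_0, …, w_a` and `w_{a+1}` disintegrates through the symbol kernel; given the
  -- past, the inner integral is zero by the definition of `B̂`.
  rw [← integral_map (f := Φ) (φ := fun w : ℕ → Fin n => (r w, w (a + 1)))
    (by fun_prop) Measurable.of_discrete.aestronglyMeasurable, ← key,
    Measure.integral_compProd .of_finite]
  refine integral_eq_zero_of_ae (Eventually.of_forall fun v => ?_)
  change ∫ j, Φ (v, j) ∂(S.symbolLaw (Z v)) = 0
  rw [integral_symbolLaw]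
  simp only [Φ]
  have h2 : ∀ j, S.p j (Z v) * (H v * (S.extTransfer g (Z v) - g (S.extMap j (Z v)))) =
      H v * (S.p j (Z v) * (S.extTransfer g (Z v) - g (S.extMap j (Z v)))) := fun j => by ring
  simp only [h2, ← Finset.mul_sum, ← sub_extTransfer, sub_self, mul_zero]

/-- The martingale of the deviations of `g` along the block process. -/
noncomputable def deviation (S : GIFSpdp X m n) (x : Fin m → X) (g : C(Fin m → X, ℝ)) (K : ℕ)
    (w : ℕ → Fin n) : ℝ :=
  ∑ k ∈ Finset.range K, (S.extTransfer g (S.block x w k) - g (S.block x w (k + 1)))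

theorem measurable_deviation (S : GIFSpdp X m n) (x : Fin m → X) (g : C(Fin m → X, ℝ)) (K : ℕ) :
    Measurable (S.deviation x g K) :=
  Finset.measurable_fun_sum _ fun k _ =>
    (S.measurable_comp_block x k (S.extTransfer g)).sub (S.measurable_comp_block x (k + 1) g)

theorem abs_deviation_succ_sub_le [CompactSpace X] (S : GIFSpdp X m n) (x : Fin m → X)
    (g : C(Fin m → X, ℝ)) (K : ℕ) (w : ℕ → Fin n) :
    |S.deviation x g (K + 1) w - S.deviation x g K w| ≤ 2 * ‖g‖ := by
  rw [deviation, Finset.sum_range_succ, ← deviation, add_sub_cancel_left]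
  have hb : ∀ y, -‖g‖ ≤ g y ∧ g y ≤ ‖g‖ := fun y => abs_le.1 (g.norm_coe_le_norm y)
  have h1 := S.extTransfer_le (fun y => (hb y).2) (S.block x w K)
  have h2 := S.le_extTransfer (fun y => (hb y).1) (S.block x w K)
  have h3 := hb (S.block x w (K + 1))
  rw [abs_le]
  constructor <;> linarith

theorem abs_deviation_le [CompactSpace X] (S : GIFSpdp X m n) (x : Fin m → X)
    (g : C(Fin m → X, ℝ)) (K : ℕ) (w : ℕ → Fin n) : |S.deviation x g K w| ≤ 2 * ‖g‖ * K := by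
  induction K with
  | zero => simp [deviation]
  | succ K ih =>
    have h1 := S.abs_deviation_succ_sub_le x g K w
    have h2 := abs_sub_abs_le_abs_sub (S.deviation x g (K + 1) w) (S.deviation x g K w)
    push_cast
    linarith

theorem integrable_deviation_sq [CompactSpace X] (S : GIFSpdp X m n) (x : Fin m → X)
    (g : C(Fin m → X, ℝ)) (K : ℕ) :
    Integrable (fun w => S.deviation x g K w ^ 2) (S.symbolMeasure x) := by
  refine Integrable.of_bound ((S.measurable_deviation x g K).pow_const 2).aestronglyMeasurable
    ((2 * ‖g‖ * K) ^ 2) (Eventually.of_forall fun w => ?_)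
  rw [Real.norm_eq_abs, abs_pow]
  gcongr
  exact S.abs_deviation_le x g K w

/-- For `K = a + 1` the deviation depends only on `w_0, …, w_a`, so the Markov property applies; for
`K = 0` it vanishes. -/
theorem integral_deviation_mul_eq_zero (S : GIFSpdp X m n) (x : Fin m → X)
    (g : C(Fin m → X, ℝ)) (K : ℕ) :
    ∫ w, S.deviation x g K w * (S.deviation x g (K + 1) w - S.deviation x g K w)
      ∂(S.symbolMeasure x) = 0 := by
  cases K with
  | zero => simp [deviation]
  | succ a =>
    rw [← S.integral_mul_extTransfer_sub x g a fun v => S.deviation x g (a + 1) (extendWord v)]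
    congr 1
    funext w
    congr 1
    · refine Finset.sum_congr rfl fun k hk => ?_
      rw [Finset.mem_range] at hk
      rw [S.block_extendWord x w (by omega), S.block_extendWord x w (by omega)]
    · rw [deviation, Finset.sum_range_succ, ← deviation, add_sub_cancel_left]

/-- Increments are orthogonal to the past, so each step adds only its own second moment, at most `(2
* ‖g‖) ^ 2`. -/
theorem integral_deviation_sq_le [CompactSpace X] (S : GIFSpdp X m n) (x : Fin m → X)
    (g : C(Fin m → X, ℝ)) (K : ℕ) :
    ∫ w, S.deviation x g K w ^ 2 ∂(S.symbolMeasure x) ≤ (2 * ‖g‖) ^ 2 * K := by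
  induction K with
  | zero => simp [deviation]
  | succ K ih =>
    set M := S.deviation x g K
    set E : (ℕ → Fin n) → ℝ := fun w => S.deviation x g (K + 1) w - M w with hE
    have hEm : Measurable E := (S.measurable_deviation x g _).sub (S.measurable_deviation x g _)
    have hEb : ∀ w, |E w| ≤ 2 * ‖g‖ := S.abs_deviation_succ_sub_le x g K
    have hME : Integrable (fun w => M w * E w) (S.symbolMeasure x) := by
      refine Integrable.of_bound ((S.measurable_deviation x g K).mul hEm).aestronglyMeasurable
        (2 * ‖g‖ * K * (2 * ‖g‖)) (Eventually.of_forall fun w => ?_)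
      rw [Real.norm_eq_abs, abs_mul]
      gcongr
      · exact S.abs_deviation_le x g K w
      · exact hEb w
    have hE2 : Integrable (fun w => E w ^ 2) (S.symbolMeasure x) := by
      refine Integrable.of_bound (hEm.pow_const 2).aestronglyMeasurable
        ((2 * ‖g‖) ^ 2) (Eventually.of_forall fun w => ?_)
      rw [Real.norm_eq_abs, abs_pow]
      gcongr
      exact hEb w
    have hsplit : ∀ w, S.deviation x g (K + 1) w ^ 2 = M w ^ 2 + 2 * (M w * E w) + E w ^ 2 :=
      fun w => by simp only [hE]; ring
    have hE2le : ∫ w, E w ^ 2 ∂(S.symbolMeasure x) ≤ (2 * ‖g‖) ^ 2 := by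
      have := integral_mono hE2 (integrable_const ((2 * ‖g‖) ^ 2))
        (fun w => sq_le_sq' (abs_le.1 (hEb w)).1 (abs_le.1 (hEb w)).2)
      simpa using this
    have hM2 : Integrable (fun w => M w ^ 2) (S.symbolMeasure x) := S.integrable_deviation_sq x g K
    have hcross : ∫ w, M w * E w ∂(S.symbolMeasure x) = 0 := S.integral_deviation_mul_eq_zero x g K
    simp only [hsplit]
    clear_value M E
    have hsum : Integrable (fun w => M w ^ 2 + 2 * (M w * E w)) (S.symbolMeasure x) :=
      hM2.add (hME.const_mul 2)
    rw [integral_add hsum hE2, integral_add hM2 (hME.const_mul 2),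
      integral_const_mul, hcross]
    push_cast
    linarith

theorem ae_tendsto_deviation_div [CompactSpace X] (S : GIFSpdp X m n) (x : Fin m → X)
    (g : C(Fin m → X, ℝ)) :
    ∀ᵐ w ∂(S.symbolMeasure x), Tendsto (fun K : ℕ => S.deviation x g K w / K) atTop (𝓝 0) :=
  ae_tendsto_div_of_integral_sq_le (S.measurable_deviation x g) (S.abs_deviation_succ_sub_le x g)
    (S.integrable_deviation_sq x g) (S.integral_deviation_sq_le x g)

end GIFSpdp

/-! ### From deviations to orbit averages -/

namespace GIFSpdp

variable {X : Type*} [MetricSpace X] [CompactSpace X] {m n : ℕ}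

/-- The sum of `B̂ g - g` over the blocks differs from the deviation by the telescoping term `g
(Z_K) - g (Z_0)`, which is bounded. -/
theorem tendsto_average_extTransfer_sub (S : GIFSpdp X m n) {x : Fin m → X} {w : ℕ → Fin n}
    {g : C(Fin m → X, ℝ)} (h : Tendsto (fun K : ℕ => S.deviation x g K w / K) atTop (𝓝 0)) :
    Tendsto (fun K : ℕ => (∑ k ∈ Finset.range K, S.extTransfer g (S.block x w k)) / K -
      (∑ k ∈ Finset.range K, g (S.block x w k)) / K) atTop (𝓝 0) := by
  have hb : Tendsto (fun K : ℕ => (g (S.block x w K) - g (S.block x w 0)) / (K : ℝ)) atTop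
      (𝓝 0) := by
    refine squeeze_zero_norm (fun K => ?_) (tendsto_const_div_atTop_nhds_zero_nat (‖g‖ + ‖g‖))
    rw [norm_div, Real.norm_natCast]
    gcongr
    exact (norm_sub_le _ _).trans (add_le_add (g.norm_coe_le_norm _) (g.norm_coe_le_norm _))
  have hadd := h.add hb
  rw [add_zero] at hadd
  refine hadd.congr fun K => ?_
  rw [← Finset.sum_range_sub (fun k => g (S.block x w k)), deviation, ← add_div, ← sub_div,
    ← Finset.sum_add_distrib, ← Finset.sum_sub_distrib]
  congr 1
  exact Finset.sum_congr rfl fun k _ => by ring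

/-- If the deviations of all iterates of `g` are sublinear along `w`, then the averages of `g` along
the block process have the uniform limit of the iterates as their limit. -/
theorem tendsto_average_block (S : GIFSpdp X m n) {x : Fin m → X} {w : ℕ → Fin n}
    {g : C(Fin m → X, ℝ)} {c : ℝ}
    (hc : Tendsto (fun N => S.extTransfer^[N] g) atTop (𝓝 (ContinuousMap.const _ c)))
    (h : ∀ N, Tendsto (fun K : ℕ => S.deviation x (S.extTransfer^[N] g) K w / K) atTop (𝓝 0)) :
    Tendsto (fun K : ℕ => (∑ k ∈ Finset.range K, g (S.block x w k)) / K) atTop (𝓝 c) := by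
  have hiter : ∀ N, Tendsto (fun K : ℕ =>
      (∑ k ∈ Finset.range K, S.extTransfer^[N] g (S.block x w k)) / K -
        (∑ k ∈ Finset.range K, g (S.block x w k)) / K) atTop (𝓝 0) := by
    intro N
    induction N with
    | zero => simp
    | succ N ih =>
      have hadd := (S.tendsto_average_extTransfer_sub (h N)).add ih
      rw [add_zero] at hadd
      simp only [Function.iterate_succ_apply']
      exact hadd.congr fun K => by ring
  -- The form with strict inequality `K > K₀` ensures `K > 0`, needed to write `c` as an average of
  -- constants.
  rw [Metric.tendsto_atTop']
  intro ε hε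
  obtain ⟨N, hN⟩ := ((Metric.tendsto_nhds.1 hc) (ε / 2) (half_pos hε)).exists
  obtain ⟨K₀, hK₀⟩ := eventually_atTop.1 ((Metric.tendsto_nhds.1 (hiter N)) (ε / 2) (half_pos hε))
  refine ⟨K₀, fun K hK => ?_⟩
  have h1 := hK₀ K hK.le
  have hKpos : (0 : ℝ) < K := by exact_mod_cast Nat.zero_lt_of_lt hK
  have h2 : |(∑ k ∈ Finset.range K, S.extTransfer^[N] g (S.block x w k)) / K - c| ≤ ε / 2 := by
    have e1 : (∑ k ∈ Finset.range K, S.extTransfer^[N] g (S.block x w k)) / K - c =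
        (∑ k ∈ Finset.range K, (S.extTransfer^[N] g (S.block x w k) - c)) / K := by
      rw [Finset.sum_sub_distrib]
      simp
      field_simp
    rw [e1, abs_div, abs_of_pos hKpos, div_le_iff₀ hKpos]
    refine (Finset.abs_sum_le_sum_abs _ _).trans ?_
    refine (Finset.sum_le_card_nsmul _ _ (ε / 2) fun k _ => ?_).trans ?_
    · exact (ContinuousMap.dist_apply_le_dist (S.block x w k)).trans hN.le
    · simp [mul_comm]
  rw [Real.dist_eq, sub_zero] at h1
  rw [Real.dist_eq, abs_lt]
  have := abs_lt.1 h1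
  have := abs_le.1 h2
  constructor <;> linarith

end GIFSpdp

/-- Convergence of averages passes from a dense set of continuous functions to all of them. -/
theorem ContinuousMap.tendsto_average_of_dense {X : Type*} [TopologicalSpace X] [CompactSpace X]
    [MeasurableSpace X] [OpensMeasurableSpace X] (μ : Measure X) [IsProbabilityMeasure μ]
    (y : ℕ → X) {s : Set C(X, ℝ)} (hs : Dense s)
    (h : ∀ f ∈ s, Tendsto (fun K : ℕ => (∑ k ∈ Finset.range K, f (y k)) / K) atTop
      (𝓝 (∫ t, f t ∂μ))) (f : C(X, ℝ)) :
    Tendsto (fun K : ℕ => (∑ k ∈ Finset.range K, f (y k)) / K) atTop (𝓝 (∫ t, f t ∂μ)) := by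
  have hint : ∀ f : C(X, ℝ), Integrable (fun t => f t) μ := fun f =>
    f.continuous.integrable_of_hasCompactSupport (HasCompactSupport.of_compactSpace _)
  rw [Metric.tendsto_atTop]
  intro ε hε
  obtain ⟨g, hgs, hfg⟩ := hs.exists_dist_lt f (ε := ε / 4) (by positivity)
  obtain ⟨K₀, hK₀⟩ := Metric.tendsto_atTop.1 (h g hgs) (ε / 4) (by positivity)
  refine ⟨K₀, fun K hK => ?_⟩
  have hpt : ∀ t, |f t - g t| ≤ ε / 4 := fun t =>
    (ContinuousMap.dist_apply_le_dist t).trans hfg.le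
  have h1 : |(∑ k ∈ Finset.range K, f (y k)) / K - (∑ k ∈ Finset.range K, g (y k)) / K| ≤
      ε / 4 := by
    rw [← sub_div, ← Finset.sum_sub_distrib, abs_div, Nat.abs_cast]
    refine div_le_of_le_mul₀ (by positivity) (by positivity) ?_
    refine (Finset.abs_sum_le_sum_abs _ _).trans ?_
    refine (Finset.sum_le_card_nsmul _ _ (ε / 4) fun k _ => hpt _).trans ?_
    simp [mul_comm]
  have h2 : |(∫ t, f t ∂μ) - ∫ t, g t ∂μ| ≤ ε / 4 := by
    rw [← integral_sub (hint f) (hint g)]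
    simpa using norm_integral_le_of_norm_le_const (μ := μ)
      (f := fun t => f t - g t) (Eventually.of_forall hpt)
  have h3 := hK₀ K hK
  rw [Real.dist_eq] at h3 ⊢
  have := abs_le.1 h1
  have := abs_le.1 h2
  have := abs_lt.1 h3
  rw [abs_lt]
  constructor <;> linarith

theorem mainTheorem1 {X : Type*} [MetricSpace X] [CompactSpace X] [Nonempty X]
    [MeasurableSpace X] [BorelSpace X] {m n : ℕ} (hm : 1 ≤ m)
    (S : GIFSpdp X m n) (h1 : S.E1) (h2 : S.E2) :
    ∃ α : ProbabilityMeasure (Fin m → X), S.IsExtendedHutchinson α ∧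
      ∃ μ : ProbabilityMeasure X,
        (∀ i : Fin m, (α : Measure (Fin m → X)).map (fun z => z i) = (μ : Measure X)) ∧
        ∀ x : Fin m → X, ∃ Ω : Set (ℕ → Fin n), MeasurableSet Ω ∧ S.symbolMeasure x Ω = 1 ∧
          ∀ w ∈ Ω, ∀ f : C(X, ℝ),
            Tendsto (fun K : ℕ => (1 / (K : ℝ)) * ∑ k ∈ Finset.range K, f (S.orbit x w k))
              atTop (𝓝 (∫ t, f t ∂(μ : Measure X))) := by
  obtain ⟨α, hα, hlim⟩ := S.exists_isExtendedHutchinson hm h1 h2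
  let e : C(Fin m → X, X) := ⟨fun z => z ⟨0, hm⟩, by fun_prop⟩
  have hμ : IsProbabilityMeasure ((α : Measure (Fin m → X)).map e) :=
    Measure.isProbabilityMeasure_map e.continuous.measurable.aemeasurable
  refine ⟨α, hα, ⟨_, hμ⟩, S.map_eval_eq_of_extMarkov_eq hα.1 hm, fun x => ?_⟩
  -- Only countably many null sets are discarded: one for each dense test function and each iterate.
  have hae : ∀ᵐ w ∂(S.symbolMeasure x), ∀ i N : ℕ, Tendsto (fun K : ℕ =>
      S.deviation x (S.extTransfer^[N] ((TopologicalSpace.denseSeq C(X, ℝ) i).comp e)) K w / K)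
        atTop (𝓝 0) :=
    ae_all_iff.2 fun i => ae_all_iff.2 fun N => S.ae_tendsto_deviation_div x _
  obtain ⟨Ω, hΩ, hΩm, hΩsub⟩ := hae.exists_measurable_mem
  refine ⟨Ω, hΩm, (mem_ae_iff_prob_eq_one hΩm).1 hΩ, fun w hw f => ?_⟩
  simp only [one_div, inv_mul_eq_div]
  refine ContinuousMap.tendsto_average_of_dense ((α : Measure (Fin m → X)).map e)
    (S.orbit x w)
    (TopologicalSpace.denseRange_denseSeq C(X, ℝ)) ?_ f
  rintro _ ⟨i, rfl⟩
  have hblock := S.tendsto_average_block (hlim ((TopologicalSpace.denseSeq C(X, ℝ) i).comp e))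
    (hΩsub w hw i)
  rw [integral_map e.continuous.measurable.aemeasurable
    (ContinuousMap.continuous _).aestronglyMeasurable]
  -- Coordinate `0` of the block at time `k` is `x_k` by definition.
  exact hblock
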